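/- Let $\mathscr A$ be a nonzero unital complex $C^*$-algebra, and let $S_{\mathscr A}$ be its set of states, i.e. of linear functionals $\phi:\mathscr A\to\mathbb C$ with $\phi(1_{\mathscr A})=1$ that take positive elements to non-negative real numbers. Let $\mathscr E$ be a Hilbert $C^*$-module over $\mathscr A$ (inner product linear in the second variable), let $\mathscr F$ be a complex linear subspace of $\mathscr E$, not necessarily closed, let $e\in\mathscr E$, and let $f_0$ be a best approximation to $e$ in $\mathscr F$, i.e. $f_0\in\mathscr F$ and $\|e-f_0\|\le\|e-f\|$ for all $f\in\mathscr F$. For $\phi\in S_{\mathscr A}$ let $\mathscr L=\{x\in\mathscr E:\phi(\langle x|x\rangle)=0\}$, equip $\mathscr E/\mathscr L$ with the inner product $\langle x+\mathscr L|y+\mathscr L\rangle=\phi(\langle x|y\rangle)$, let $\mathscr F/\mathscr L$ be the image of $\mathscr F$ in $\mathscr E/\mathscr L$, and put $$M_{e,\mathscr F}(\phi)=\sup\Big\{\phi(\langle e-f_0|e-f_0\rangle)-\sum_\alpha|\phi(\langle e-f_0|f_\alpha\rangle)|^2\Big\},$$ where the supremum is taken over all orthonormal bases $\{f_\alpha+\mathscr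 L\}$ $(f_\alpha\in\mathscr F)$ of $\mathscr F/\mathscr L$, an orthonormal basis of an inner product space being a maximal orthonormal subset. Then $$\operatorname{dist}(e,\mathscr F)^2=\max\{M_{e,\mathscr F}(\phi):\phi\in S_{\mathscr A}\},$$ where $\operatorname{dist}(e,\mathscr F)=\inf\{\|e-f\|:f\in\mathscr F\}$; in particular the maximum is attained. -/

import Mathlib

open scoped ComplexOrder InnerProductSpace

/-- The set of states of a unital C⋆-algebra: the positive linear functionals `φ` with
`φ 1 = 1`. -/
def CStarState (A : Type*) [CStarAlgebra A] [PartialOrder A] [StarOrderedRing A] :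
    Set (A →ₚ[ℂ] ℂ) :=
  {φ | φ 1 = 1}

/-- `f₀` is a best approximation to `e` in the subspace `F`. -/
def IsBestApproximation {E : Type*} [NormedAddCommGroup E] [NormedSpace ℂ E]
    (F : Submodule ℂ E) (e f₀ : E) : Prop :=
  f₀ ∈ F ∧ ∀ f ∈ F, ‖e - f₀‖ ≤ ‖e - f‖

section StateSpace

variable {A : Type*} [CStarAlgebra A] [PartialOrder A] [StarOrderedRing A] (φ : A →ₚ[ℂ] ℂ)
  (E : Type*) [NormedAddCommGroup E] [NormedSpace ℂ E] [SMul A E] [CStarModule A E]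

/-- The semi-inner product `(x, y) ↦ φ ⟪x, y⟫` on a Hilbert C⋆-module. -/
noncomputable abbrev statePreInner : PreInnerProductSpace.Core ℂ E where
  inner x y := φ ⟪x, y⟫_A
  conj_inner_symm x y := by
    rw [← Complex.star_def, ← map_star φ, CStarModule.star_inner]
  re_inner_nonneg x :=
    (RCLike.nonneg_iff.mp (φ.map_nonneg (CStarModule.inner_self_nonneg (A := A)))).1
  add_left x y z := by rw [CStarModule.inner_add_left, map_add]
  smul_left x y r := by
    rw [CStarModule.inner_smul_left_complex, map_smul]; rfl

/-- Cauchy-Schwarz for the semi-inner product, in the degenerate case. -/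
theorem state_inner_eq_zero {x : E} (hx : φ ⟪x, x⟫_A = 0) (y : E) : φ ⟪x, y⟫_A = 0 := by
  have h := @InnerProductSpace.Core.inner_mul_inner_self_le ℂ E _ _ _ (statePreInner φ E) x y
  change ‖φ ⟪x, y⟫_A‖ * ‖φ ⟪y, x⟫_A‖ ≤ (φ ⟪x, x⟫_A).re * (φ ⟪y, y⟫_A).re at h
  have hs : ‖φ ⟪y, x⟫_A‖ = ‖φ ⟪x, y⟫_A‖ := by
    rw [← CStarModule.star_inner x y, map_star, norm_star]
  rw [hx, hs] at h
  simp only [Complex.zero_re, zero_mul] at h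
  have h0 := norm_nonneg (φ ⟪x, y⟫_A)
  exact norm_eq_zero.mp (by nlinarith)

theorem state_inner_eq_zero' {x : E} (hx : φ ⟪x, x⟫_A = 0) (y : E) : φ ⟪y, x⟫_A = 0 := by
  rw [← CStarModule.star_inner x y, map_star, state_inner_eq_zero φ E hx, star_zero]

/-- The subspace `{x | φ ⟪x, x⟫ = 0}` of a Hilbert C⋆-module. -/
def stateKer : Submodule ℂ E where
  carrier := {x | φ ⟪x, x⟫_A = 0}
  zero_mem' := by simp
  add_mem' {x y} hx hy := by
    simp only [Set.mem_ofPred_eq] at hx hy ⊢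
    rw [CStarModule.inner_add_left, map_add, state_inner_eq_zero' φ E, state_inner_eq_zero' φ E,
      add_zero]
    all_goals
      rw [CStarModule.inner_add_right, map_add]
      simp [hx, hy, state_inner_eq_zero φ E hx, state_inner_eq_zero φ E hy]
  smul_mem' c x hx := by
    simp only [Set.mem_ofPred_eq] at hx ⊢
    rw [CStarModule.inner_smul_right_complex, CStarModule.inner_smul_left_complex, map_smul,
      map_smul, hx, smul_zero, smul_zero]

/-- The quotient of a Hilbert C⋆-module by `{x | φ ⟪x, x⟫ = 0}`. It is given its own name so that
it carries the norm of the inner product induced by `φ`, and not the quotient norm. -/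
def StateQuotient : Type _ := E ⧸ stateKer φ E

noncomputable instance : AddCommGroup (StateQuotient φ E) :=
  inferInstanceAs (AddCommGroup (E ⧸ stateKer φ E))

noncomputable instance : Module ℂ (StateQuotient φ E) :=
  inferInstanceAs (Module ℂ (E ⧸ stateKer φ E))

/-- The quotient map `x ↦ x + L`. -/
noncomputable def stateMk : E →ₗ[ℂ] StateQuotient φ E := (stateKer φ E).mkQ

/-- The inner product `⟪x + L, y + L⟫ = φ ⟪x, y⟫` on the quotient. -/
noncomputable abbrev stateInnerCore : InnerProductSpace.Core ℂ (StateQuotient φ E) where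
  inner := Quotient.lift₂ (fun x y : E => φ ⟪x, y⟫_A) (by
    intro a b c d hac hbd
    have h1 : φ ⟪a - c, a - c⟫_A = 0 := (Submodule.quotientRel_def _).mp hac
    have h2 : φ ⟪b - d, b - d⟫_A = 0 := (Submodule.quotientRel_def _).mp hbd
    have e1 := state_inner_eq_zero φ E h1 b
    have e2 := state_inner_eq_zero' φ E h2 c
    rw [CStarModule.inner_sub_left, map_sub, sub_eq_zero] at e1
    rw [CStarModule.inner_sub_right, map_sub, sub_eq_zero] at e2
    exact e1.trans e2)
  conj_inner_symm := by
    rintro ⟨x⟩ ⟨y⟩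
    exact (statePreInner φ E).conj_inner_symm x y
  re_inner_nonneg := by
    rintro ⟨x⟩
    exact (statePreInner φ E).re_inner_nonneg x
  add_left := by
    rintro ⟨x⟩ ⟨y⟩ ⟨z⟩
    exact (statePreInner φ E).add_left x y z
  smul_left := by
    rintro ⟨x⟩ ⟨y⟩ r
    exact (statePreInner φ E).smul_left x y r
  definite := by
    rintro ⟨x⟩ h
    exact (Submodule.Quotient.mk_eq_zero (stateKer φ E)).mpr h

noncomputable instance : NormedAddCommGroup (StateQuotient φ E) :=
  (stateInnerCore φ E).toNormedAddCommGroup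

noncomputable instance : InnerProductSpace ℂ (StateQuotient φ E) :=
  InnerProductSpace.ofCore (stateInnerCore φ E).toCore

noncomputable instance : Inner ℂ (StateQuotient φ E) := InnerProductSpace.toInner

variable {E}

theorem state_inner_mk (x y : E) : ⟪stateMk φ E x, stateMk φ E y⟫_ℂ = φ ⟪x, y⟫_A := rfl

/-- `S` is an orthonormal basis of `F/L` in `E/L`: a maximal orthonormal subset of the image of
`F` in `E/L`. -/
def IsOrthonormalBasisOfImage (F : Submodule ℂ E) (S : Set (StateQuotient φ E)) : Prop :=
  Maximal (fun T : Set (StateQuotient φ E) =>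
    T ⊆ F.map (stateMk φ E) ∧ Orthonormal ℂ ((↑) : T → StateQuotient φ E)) S

/-- The numbers `φ ⟪e - f₀, e - f₀⟫ - ∑ |φ ⟪e - f₀, f_α⟫|²`, one for each orthonormal basis
`{f_α + L}` of `F/L` in `E/L`; here `φ ⟪e - f₀, f_α⟫` is `⟪(e - f₀) + L, f_α + L⟫`. -/
def stateDefects (F : Submodule ℂ E) (e f₀ : E) : Set ℝ :=
  {r | ∃ S : Set (StateQuotient φ E), IsOrthonormalBasisOfImage φ F S ∧
    r = (φ ⟪e - f₀, e - f₀⟫_A).re -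
      ∑' u : S, ‖⟪stateMk φ E (e - f₀), (u : StateQuotient φ E)⟫_ℂ‖ ^ 2}

/-- The quantity `M_{e,F}(φ)`, formed with the best approximation `f₀`: the supremum of
`φ ⟪e - f₀, e - f₀⟫ - ∑ |φ ⟪e - f₀, f_α⟫|²` over all orthonormal bases of `F/L`. -/
noncomputable def stateM (F : Submodule ℂ E) (e f₀ : E) : ℝ :=
  sSup (stateDefects φ F e f₀)

/-- An orthonormal basis exists, so the supremum is over a nonempty set. -/
theorem stateDefects_nonempty (F : Submodule ℂ E) (e f₀ : E) :
    (stateDefects φ F e f₀).Nonempty := by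
  obtain ⟨S, -, hS⟩ := zorn_subset_nonempty
    {T : Set (StateQuotient φ E) |
      T ⊆ F.map (stateMk φ E) ∧ Orthonormal ℂ ((↑) : T → StateQuotient φ E)}
    (fun c hc cc _ => ⟨⋃₀ c, ⟨Set.sUnion_subset fun t ht => (hc ht).1,
      orthonormal_sUnion_of_directed cc.directedOn fun t ht => (hc ht).2⟩,
      fun _ => Set.subset_sUnion_of_mem⟩)
    ∅ ⟨Set.empty_subset _, by simp [Orthonormal, Pairwise]⟩
  exact ⟨_, S, hS, rfl⟩

/-- The sums in `stateDefects` converge. -/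
theorem summable_state_inner (F : Submodule ℂ E) (x : E) {S : Set (StateQuotient φ E)}
    (hS : IsOrthonormalBasisOfImage φ F S) :
    Summable fun u : S => ‖⟪stateMk φ E x, (u : StateQuotient φ E)⟫_ℂ‖ ^ 2 := by
  refine (hS.prop.2.inner_products_summable (stateMk φ E x)).congr fun u => ?_
  rw [norm_inner_symm]

/-- The supremum in `stateM` is over a set that is bounded above. -/
theorem stateDefects_bddAbove (F : Submodule ℂ E) (e f₀ : E) :
    BddAbove (stateDefects φ F e f₀) := by
  refine ⟨(φ ⟪e - f₀, e - f₀⟫_A).re, ?_⟩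
  rintro r ⟨S, -, rfl⟩
  exact sub_le_self _ (tsum_nonneg fun _ => sq_nonneg _)

end StateSpace

/-! Put x = e - f₀, so that dist(e, F) = ‖x‖. For any state φ each defect is at most φ⟪x, x⟫ ≤ ‖x‖².
Equality needs a state with φ⟪x, x⟫ = ‖x‖² and φ⟪x, f⟫ = 0 for all f ∈ F, for then every sum
vanishes (`exists_state_orthogonal`). Such a state comes from Hahn-Banach: the real span of b = ‖x‖²
- ⟪x, x⟫ and ⟪x, F⟫ is separated from the open convex set of elements with strictly positive real
part (`exists_state_re_eq_zero`). If the two met, a small step from x along some f ∈ F would shorten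
x, against minimality (`not_algebraMap_le_of_norm_le`). -/

/-- A real subspace of a unital C⋆-algebra that contains no element whose real part is bounded
below by a positive scalar is annihilated by the real part of some state. -/
theorem exists_state_re_eq_zero {A : Type*} [CStarAlgebra A] [PartialOrder A] [StarOrderedRing A]
    (V : Submodule ℝ A) (hV : ∀ a ∈ V, ∀ δ : ℝ, 0 < δ → ¬ algebraMap ℝ A δ ≤ a + star a) :
    ∃ φ ∈ CStarState A, ∀ a ∈ V, (φ a).re = 0 := by
  let K : Set A := {a | ∃ δ : ℝ, 0 < δ ∧ algebraMap ℝ A δ ≤ a + star a}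
  have hconv : Convex ℝ K := by
    rintro a ⟨δ, hδ, ha⟩ b ⟨ε, hε, hb⟩ s t hs ht hst
    refine ⟨s * δ + t * ε, ?_, ?_⟩
    · rcases hs.eq_or_lt with rfl | hs
      · obtain rfl : t = 1 := by linarith
        simpa using hε
      · nlinarith [mul_pos hs hδ, mul_nonneg ht hε.le]
    · have h1 := add_le_add (smul_le_smul_of_nonneg_left ha hs) (smul_le_smul_of_nonneg_left hb ht)
      have e1 : star (s • a + t • b) = s • star a + t • star b := by simp [star_smul]
      rw [e1, map_add, map_mul, map_mul, ← Algebra.smul_def, ← Algebra.smul_def]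
      convert h1 using 1
      simp only [smul_add]; abel
  have hopen : IsOpen K := by
    rw [Metric.isOpen_iff]
    rintro a ⟨δ, hδ, ha⟩
    refine ⟨δ / 4, by positivity, fun b hb => ⟨δ / 2, by positivity, ?_⟩⟩
    have hsa : IsSelfAdjoint ((b - a) + star (b - a)) := IsSelfAdjoint.add_star_self _
    have hn : ‖(b - a) + star (b - a)‖ ≤ δ / 2 := by
      rw [Metric.mem_ball, dist_eq_norm] at hb
      have := norm_add_le (b - a) (star (b - a))
      rw [norm_star] at this
      linarith
    have h1 := hsa.neg_algebraMap_norm_le_self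
    have h2 := neg_le_neg (algebraMap_mono A hn)
    have h3 := add_le_add ha (h2.trans h1)
    convert h3 using 1
    · rw [← map_neg, ← map_add]; congr 1; ring
    · rw [star_sub]; abel
  have hdisj : Disjoint K (V : Set A) := Set.disjoint_left.mpr fun a ⟨δ, hδ, ha⟩ haV =>
    hV a haV δ hδ ha
  obtain ⟨g, u, hgK, hgV⟩ :=
    RCLike.geometric_hahn_banach_open (𝕜 := ℂ) hconv hopen V.convex hdisj
  simp only [RCLike.re_to_complex] at hgK hgV
  have hV0 : ∀ a ∈ V, (g a).re = 0 := by
    intro a ha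
    by_contra hne
    -- This multiple of `a` has Re g = u - 1, below the bound u that holds on V.
    have h1 := hgV _ (V.smul_mem ((u - 1) / (g a).re) ha)
    rw [ContinuousLinearMap.map_smul_of_tower, Complex.smul_re, smul_eq_mul,
      div_mul_cancel₀ _ hne] at h1
    linarith
  have hu : u ≤ 0 := by simpa using hgV 0 V.zero_mem
  have hKneg : ∀ a ∈ K, (g a).re < 0 := fun a ha => (hgK a ha).trans_le hu
  have hone : ∀ ε : ℝ, 0 < ε → algebraMap ℝ A ε ∈ K := fun ε hε => ⟨ε, hε, by
    rw [IsSelfAdjoint.star_eq (IsSelfAdjoint.algebraMap A (.all ε)), ← map_add]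
    exact algebraMap_mono A (by linarith)⟩
  have hg1 : (g 1).re < 0 := by simpa using hKneg _ (hone 1 one_pos)
  have hre : ∀ a : A, 0 ≤ a + star a → (g a).re ≤ 0 := by
    intro a ha
    by_contra! hpos
    -- Adding this scalar moves `a` into K and makes Re g exactly 0, but Re g < 0 on K.
    have hε : 0 < (g a).re / (-(g 1).re) := div_pos hpos (by linarith)
    have h1 : a + algebraMap ℝ A ((g a).re / (-(g 1).re)) ∈ K := by
      refine ⟨_, mul_pos two_pos hε, ?_⟩
      rw [star_add, IsSelfAdjoint.star_eq (IsSelfAdjoint.algebraMap A (.all _)), two_mul, map_add]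
      have := add_le_add_left ha (algebraMap ℝ A ((g a).re / (-(g 1).re)) +
        algebraMap ℝ A ((g a).re / (-(g 1).re)))
      rw [zero_add] at this
      exact this.trans_eq (by abel)
    have h2 := hKneg _ h1
    rw [map_add, Algebra.algebraMap_eq_smul_one, ContinuousLinearMap.map_smul_of_tower,
      Complex.add_re, Complex.smul_re, smul_eq_mul] at h2
    have : (g a).re / (-(g 1).re) * (g 1).re = -(g a).re := by
      field_simp [hg1.ne]
    linarith
  have him : ∀ a : A, IsSelfAdjoint a → (g a).im = 0 := by
    intro a ha
    -- For imaginary z, z • a has real part zero, so `hre` applies to both I • a and -I • a.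
    have key : ∀ z : ℂ, z + star z = 0 → (z * g a).re ≤ 0 := fun z hz => by
      have := hre (z • a) (by rw [star_smul, ha.star_eq, ← add_smul, hz, zero_smul])
      simpa using this
    have h1 := key Complex.I (by simp)
    have h2 := key (-Complex.I) (by simp)
    simp at h1 h2
    linarith
  have hg1im : (g 1).im = 0 := him 1 (.one A)
  have hg1r : g 1 = ((g 1).re : ℂ) := Complex.ext (by simp) (by simp [hg1im])
  have hg1ne : g 1 ≠ 0 := fun h => by simp [h] at hg1
  refine ⟨PositiveLinearMap.mk₀ ((g 1)⁻¹ • (g : A →ₗ[ℂ] ℂ)) ?_, ?_, ?_⟩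
  · intro a ha
    have hsa : IsSelfAdjoint a := .of_nonneg ha
    have h1 : g a = ((g a).re : ℂ) := Complex.ext (by simp) (by simp [him a hsa])
    have h2 : (g a).re ≤ 0 := hre a (by rw [hsa.star_eq]; exact add_nonneg ha ha)
    change 0 ≤ (g 1)⁻¹ * g a
    rw [h1, hg1r, ← Complex.ofReal_inv, ← Complex.ofReal_mul, Complex.zero_le_real]
    exact mul_nonneg_of_nonpos_of_nonpos (inv_nonpos.mpr hg1.le) h2
  · change (g 1)⁻¹ * g 1 = 1
    exact inv_mul_cancel₀ hg1ne
  · intro a ha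
    change ((g 1)⁻¹ * g a).re = 0
    rw [hg1r, ← Complex.ofReal_inv, Complex.re_ofReal_mul, hV0 a ha, mul_zero]

theorem inner_self_le_algebraMap {A : Type*} [CStarAlgebra A] [PartialOrder A]
    [StarOrderedRing A] {E : Type*} [NormedAddCommGroup E] [NormedSpace ℂ E] [SMul A E]
    [CStarModule A E] (x : E) : ⟪x, x⟫_A ≤ algebraMap ℝ A (‖x‖ ^ 2) := by
  rw [CStarModule.norm_sq_eq A]
  exact CStarModule.isSelfAdjoint_inner_self.le_algebraMap_norm_self

theorem CStarState.map_algebraMap {A : Type*} [CStarAlgebra A] [PartialOrder A]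
    [StarOrderedRing A] {φ : A →ₚ[ℂ] ℂ} (hφ : φ ∈ CStarState A) (r : ℝ) :
    φ (algebraMap ℝ A r) = r := by
  have h1 : φ 1 = 1 := hφ
  rw [Algebra.algebraMap_eq_smul_one, PositiveLinearMap.map_smul_of_tower, h1]
  simp

/-- If `0` is a best approximation to `x` in `F`, then `‖x‖ ^ 2 - ⟪x, x⟫ + ⟪x, f⟫` has no strictly
positive real part. -/
theorem not_algebraMap_le_of_norm_le {A : Type*} [CStarAlgebra A] [PartialOrder A]
    [StarOrderedRing A] [Nontrivial A] {E : Type*} [NormedAddCommGroup E] [NormedSpace ℂ E]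
    [SMul A E] [CStarModule A E] (F : Submodule ℂ E) (x : E) (hx : ∀ f ∈ F, ‖x‖ ≤ ‖x - f‖)
    {f : E} (hf : f ∈ F) {δ : ℝ} (hδ : 0 < δ) :
    ¬ algebraMap ℝ A δ ≤ algebraMap ℝ A (2 * ‖x‖ ^ 2) - 2 • ⟪x, x⟫_A + (⟪x, f⟫_A + ⟪f, x⟫_A) := by
  intro h
  -- s ≤ 1/2 keeps the weight 1 - 2s of `h2` nonnegative; s‖f‖² < δ lets the gain sδ beat the
  -- quadratic cost s²‖f‖².
  obtain ⟨s, hs0, hs1, hs⟩ : ∃ s : ℝ, 0 < s ∧ s ≤ 1 / 2 ∧ s * ‖f‖ ^ 2 < δ := by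
    refine ⟨min (1 / 2) (δ / (2 * (‖f‖ ^ 2 + 1))), by positivity, min_le_left _ _, ?_⟩
    calc _ ≤ δ / (2 * (‖f‖ ^ 2 + 1)) * ‖f‖ ^ 2 := by gcongr; exact min_le_right _ _
      _ < δ := by
        rw [div_mul_eq_mul_div, div_lt_iff₀ (by positivity)]
        nlinarith [sq_nonneg ‖f‖]
  have h1 := smul_le_smul_of_nonneg_left h hs0.le
  have h2 := smul_le_smul_of_nonneg_left (inner_self_le_algebraMap (A := A) x) (show (0 : ℝ) ≤ 1 - 2 * s by linarith)
  have h3 := smul_le_smul_of_nonneg_left (inner_self_le_algebraMap (A := A) f) (sq_nonneg s)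
  have hexp : ⟪x - s • f, x - s • f⟫_A =
      ⟪x, x⟫_A - s • (⟪x, f⟫_A + ⟪f, x⟫_A) + s ^ 2 • ⟪f, f⟫_A := by
    simp only [CStarModule.inner_sub_left, CStarModule.inner_sub_right,
      CStarModule.inner_smul_left_real, CStarModule.inner_smul_right_real]
    module
  have hle : ⟪x - s • f, x - s • f⟫_A ≤
      algebraMap ℝ A (‖x‖ ^ 2 - s * δ + s ^ 2 * ‖f‖ ^ 2) := by
    have h4 := add_le_add (add_le_add h1 h2) h3
    rw [hexp]
    simp only [Algebra.algebraMap_eq_smul_one] at h4 ⊢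
    rw [← sub_nonneg] at h4 ⊢
    refine h4.trans_eq ?_
    module
  have hnonneg : 0 ≤ ‖x‖ ^ 2 - s * δ + s ^ 2 * ‖f‖ ^ 2 := by
    by_contra! hlt
    have h0 : algebraMap ℝ A (‖x‖ ^ 2 - s * δ + s ^ 2 * ‖f‖ ^ 2) = 0 :=
      le_antisymm (by simpa using algebraMap_mono A hlt.le)
        (CStarModule.inner_self_nonneg.trans hle)
    exact hlt.ne ((map_eq_zero _).mp h0)
  have hnorm : ‖x - s • f‖ ^ 2 ≤ ‖x‖ ^ 2 - s * δ + s ^ 2 * ‖f‖ ^ 2 := by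
    rw [CStarModule.norm_sq_eq A]
    exact (CStarAlgebra.norm_le_iff_le_algebraMap _ hnonneg CStarModule.inner_self_nonneg).mpr hle
  have hmin := pow_le_pow_left₀ (norm_nonneg _) (hx (s • f) (F.smul_of_tower_mem s hf)) 2
  nlinarith [mul_lt_mul_of_pos_left hs hs0]

/-- If `0` is a best approximation to `x` in `F`, then some state attains the norm of `x` and
vanishes on `⟪x, F⟫`. -/
theorem exists_state_orthogonal {A : Type*} [CStarAlgebra A] [PartialOrder A]
    [StarOrderedRing A] [Nontrivial A] {E : Type*} [NormedAddCommGroup E] [NormedSpace ℂ E]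
    [SMul A E] [CStarModule A E] (F : Submodule ℂ E) (x : E) (hx : ∀ f ∈ F, ‖x‖ ≤ ‖x - f‖) :
    ∃ φ ∈ CStarState A, (φ ⟪x, x⟫_A).re = ‖x‖ ^ 2 ∧ ∀ f ∈ F, φ ⟪x, f⟫_A = 0 := by
  set b : A := algebraMap ℝ A (‖x‖ ^ 2) - ⟪x, x⟫_A with hb
  have hb0 : 0 ≤ b := sub_nonneg.mpr (inner_self_le_algebraMap x)
  have hbsa : star b = b := (IsSelfAdjoint.of_nonneg hb0).star_eq
  let V : Submodule ℝ A := Submodule.span ℝ {b} ⊔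
    (F.map (CStarModule.innerₛₗ x : E →ₗ[ℂ] A)).restrictScalars ℝ
  have hVF : ∀ f ∈ F, ⟪x, f⟫_A ∈ V := fun f hf =>
    Submodule.mem_sup_right (Submodule.mem_map_of_mem (f := (CStarModule.innerₛₗ x : E →ₗ[ℂ] A)) hf)
  obtain ⟨φ, hφ, hφV⟩ := exists_state_re_eq_zero V (by
    intro a ha δ hδ hle
    obtain ⟨y, hy, z, hz, rfl⟩ := Submodule.mem_sup.mp ha
    obtain ⟨t, rfl⟩ := Submodule.mem_span_singleton.mp hy
    obtain ⟨f, hf, rfl⟩ := hz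
    change _ ≤ t • b + ⟪x, f⟫_A + star (t • b + ⟪x, f⟫_A) at hle
    -- The coefficient t may be nonpositive. As b ≥ 0, raising it to max t 1 keeps the bound, and
    -- dividing by max t 1 makes it 1, with f and δ rescaled.
    have hs : 0 < max t 1 := lt_max_of_lt_right one_pos
    have h1 := hle.trans <| add_le_add_left
      (smul_le_smul_of_nonneg_right (show 2 * t ≤ 2 * max t 1 by gcongr; exact le_max_left _ _) hb0)
      (⟪x, f⟫_A + ⟪f, x⟫_A) |>.trans_eq' (by
        rw [star_add, star_smul, hbsa, CStarModule.star_inner, star_trivial]; module)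
    have h2 := smul_le_smul_of_nonneg_left h1 (inv_nonneg.mpr hs.le)
    refine not_algebraMap_le_of_norm_le (A := A) F x hx
      (F.smul_of_tower_mem (max t 1)⁻¹ hf) (mul_pos (inv_pos.mpr hs) hδ) ?_
    rw [map_mul, ← Algebra.smul_def]
    refine h2.trans_eq ?_
    rw [CStarModule.inner_smul_left_real, CStarModule.inner_smul_right_real, smul_add, smul_smul,
      mul_left_comm, inv_mul_cancel₀ hs.ne', hb, mul_one]
    simp only [Algebra.algebraMap_eq_smul_one]
    module)
  refine ⟨φ, hφ, ?_, fun f hf => Complex.ext (hφV _ (hVF f hf)) ?_⟩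
  · have h := hφV b (Submodule.mem_sup_left (Submodule.mem_span_singleton_self b))
    rw [hb, map_sub, CStarState.map_algebraMap hφ, Complex.sub_re, Complex.ofReal_re] at h
    linarith
  · have h := hφV _ (hVF _ (F.smul_mem Complex.I hf))
    rw [CStarModule.inner_smul_right_complex, map_smul] at h
    simpa using h


theorem mainTheorem3 {A : Type*} [CStarAlgebra A] [PartialOrder A] [StarOrderedRing A]
    [Nontrivial A] {E : Type*} [NormedAddCommGroup E] [NormedSpace ℂ E] [SMul A E]
    [CStarModule A E] (F : Submodule ℂ E) (e f₀ : E) (hf₀ : IsBestApproximation F e f₀) :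
    IsGreatest ((fun φ : A →ₚ[ℂ] ℂ => stateM φ F e f₀) '' CStarState A)
      (Metric.infDist e (F : Set E) ^ 2) := by
  set x := e - f₀ with hx
  have hdist : Metric.infDist e (F : Set E) = ‖x‖ := by
    refine le_antisymm ?_ ((Metric.le_infDist ⟨f₀, hf₀.1⟩).mpr fun {f} hf => ?_)
    · rw [hx, ← dist_eq_norm]
      exact Metric.infDist_le_dist_of_mem hf₀.1
    · rw [dist_eq_norm]
      exact hf₀.2 f hf
  rw [hdist]
  constructor
  · obtain ⟨φ, hφ, hnorm, horth⟩ := exists_state_orthogonal (A := A) F x fun f hf => by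
      rw [hx, sub_sub]
      exact hf₀.2 _ (F.add_mem hf₀.1 hf)
    refine ⟨φ, hφ, ?_⟩
    have hdef : stateDefects φ F e f₀ = {‖x‖ ^ 2} := by
      refine Set.Nonempty.subset_singleton_iff (stateDefects_nonempty φ F e f₀) |>.mp ?_
      rintro r ⟨S, hS, rfl⟩
      have h0 : ∀ u : S, ‖⟪stateMk φ E (e - f₀), (u : StateQuotient φ E)⟫_ℂ‖ ^ 2 = 0 := by
        rintro ⟨u, hu⟩
        obtain ⟨f, hf, rfl⟩ := hS.prop.1 hu
        rw [state_inner_mk, horth f hf]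
        simp
      rw [Set.mem_singleton_iff, tsum_congr h0, tsum_zero, sub_zero, hnorm]
    change sSup (stateDefects φ F e f₀) = _
    rw [hdef, csSup_singleton]
  · rintro _ ⟨φ, hφ, rfl⟩
    refine csSup_le (stateDefects_nonempty φ F e f₀) ?_
    rintro r ⟨S, -, rfl⟩
    have h := φ.monotone' (inner_self_le_algebraMap (A := A) x)
    have h' := (Complex.le_def.mp (h.trans_eq (CStarState.map_algebraMap hφ _))).1
    exact (sub_le_self _ (tsum_nonneg fun _ => sq_nonneg _)).trans h'
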